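/- **Theorem.** Consider a Markov decision process with finite state space $\mathcal S$, finite action space $\mathcal A$, transition probabilities $\mathcal P(s'\mid s,a)$, initial distribution $d_0$ and discount factor $\gamma\in[0,1]$. Let $\pi_\theta$, $\theta\in\mathbb R^n$, be a parametrised policy that at the given $\theta$ is differentiable in $\theta$, satisfies $\pi_\theta(a\mid s)>0$ for all $s,a$, and induces an irreducible Markov chain on $\mathcal S$ (for instance an ergodic one). If $\gamma=0$, assume also that $d_0(s)>0$ for all $s$. Let $(s_t,a_t)_{t\ge0}$ denote the trajectory with $s_0\sim d_0$, $a_t\sim\pi_\theta(\cdot\mid s_t)$, $s_{t+1}\sim\mathcal P(\cdot\mid s_t,a_t)$, and let $$d_\gamma(s,a)=(1-\gamma)\sum_{t\ge0}\gamma^t\,\mathbb P(s_t=s,a_t=a)\quad(\gamma<1),\qquad d_1(s,a)=\lim_{T\to\infty}\frac1T\sum_{t=0}^T\mathbb P(s_t=s,a_t=a).$$ Let $\Phi:\mathcal S\times\mathcal A\to\mathbb R^d$ be a feature map whose $d$ coordinate functions are linearly independent, and let $\lambda\ge0$. Let $((s_t,a_t),(s_t',a_t'))$, $t\ge0$, now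 be independent samples with $(s_t,a_t)\sim d_\gamma$, $s_t'\sim\mathcal P(\cdot\mid s_t,a_t)$, $a_t'\sim\pi_\theta(\cdot\mid s_t')$. Put $\Phi_t=\Phi(s_t,a_t)$, $\Phi_t'=\Phi(s_t',a_t')$, $g_t=\nabla_\theta\log\pi_\theta(a_t\mid s_t)$, and $$A_t=\Phi_t\Phi_t^T-\gamma\,\Phi_t(\Phi_t')^T,\qquad B_t=\Phi_t g_t^T,\qquad C_t=\Phi_t\Phi_t^T .$$ Let $A=\mathbb E[A_t]$, and suppose that $A$ is nonsingular or $\lambda>0$. Let the step sizes $\varepsilon_t\ge0$ satisfy $\sum_t\varepsilon_t=\infty$ and $\sum_t\varepsilon_t^2<\infty$. From arbitrary deterministic $\alpha_0,\beta_0\in\mathbb R^{d\times n}$ and $\tau_0\in\mathbb R^n$ define $$\alpha_{t+1}=\alpha_t-\varepsilon_t\left(A_t\beta_t+\lambda\Phi_t\tau_t^T\right),\qquad \beta_{t+1}=\beta_t+\varepsilon_t\left(A_t^T\alpha_t-B_t-C_t\beta_t\right),\qquad \tau_{t+1}=\tau_t+\varepsilon_t\lambda\left(\alpha_t^T\Phi_t-\tau_t\right).$$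 1. If $\lambda>0$, then the matrix $$G=\mathbb E\begin{bmatrix}0&-A_t&-\lambda\Phi_t\\ A_t^T&-C_t&0\\ \lambda\Phi_t^T&0&-\lambda\end{bmatrix}$$ is nonsingular, and, with $h=\mathbb E\begin{bmatrix}0\\-B_t\\0\end{bmatrix}$, the iterates $d_t=\begin{bmatrix}\alpha_t\\ \beta_t\\ \tau_t^T\end{bmatrix}$ converge in probability to $-G^{-1}h$, the unique solution of $Gx+h=0$. 2. If $\lambda=0$ (and hence $A$ is nonsingular), then $G_0=\mathbb E\begin{bmatrix}0&-A_t\\ A_t^T&-C_t\end{bmatrix}$ is nonsingular, and, with $h_0=\mathbb E\begin{bmatrix}0\\-B_t\end{bmatrix}$, the iterates $\begin{bmatrix}\alpha_t\\ \beta_t\end{bmatrix}$ converge in probability to $-G_0^{-1}h_0$, while $\tau_t=\tau_0$ for all $t$. -/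

import Mathlib

open MeasureTheory ProbabilityTheory Filter Topology

-- Convergence of random matrices is measured in the Frobenius norm.
attribute [local instance] Matrix.frobeniusNormedAddCommGroup

namespace LogDensityGradient

/-- The dynamics of a finite Markov decision process: transition probabilities `trans s a s'`
and initial distribution `init`. The reward plays no role here and the discount factor is a
separate parameter. -/
structure MDP (S A : Type*) [Fintype S] where
  trans : S → A → S → ℝ
  trans_nonneg : ∀ s a s', 0 ≤ trans s a s'
  trans_sum : ∀ s a, ∑ s', trans s a s' = 1
  init : S → ℝ
  init_nonneg : ∀ s, 0 ≤ init s
  init_sum : ∑ s, init s = 1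

/-- A family of policies parametrised by `ℝⁿ`; `prob θ s a` is the probability of playing `a`
in state `s`. -/
structure Policy (n : ℕ) (S A : Type*) [Fintype A] where
  prob : EuclideanSpace ℝ (Fin n) → S → A → ℝ
  prob_nonneg : ∀ θ s a, 0 ≤ prob θ s a
  prob_sum : ∀ θ s, ∑ a, prob θ s a = 1

section Chain

variable {S A : Type*} [Fintype S] [Fintype A] {n : ℕ}

/-- Transition matrix of the Markov chain on states induced by the policy at `θ`. -/
def stateMatrix (M : MDP S A) (π : Policy n S A) (θ : EuclideanSpace ℝ (Fin n)) :
    Matrix S S ℝ :=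
  Matrix.of fun s s' => ∑ a, π.prob θ s a * M.trans s a s'

/-- `stateProb M π θ t s` is the probability that the state at time `t` is `s`. -/
def stateProb (M : MDP S A) (π : Policy n S A) (θ : EuclideanSpace ℝ (Fin n)) : ℕ → S → ℝ
  | 0 => M.init
  | t + 1 => fun s' => ∑ s, ∑ a, stateProb M π θ t s * π.prob θ s a * M.trans s a s'

/-- `pairProb M π θ t x` is the probability that the state-action pair at time `t` is `x`. -/
def pairProb (M : MDP S A) (π : Policy n S A) (θ : EuclideanSpace ℝ (Fin n)) (t : ℕ)
    (x : S × A) : ℝ :=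
  stateProb M π θ t x.1 * π.prob θ x.1 x.2

open Classical in
/-- The average (discounted) state-action distribution for `γ ∈ [0, 1]`: the normalised
discounted sum for `γ < 1` and the limit of time averages for `γ = 1`. -/
noncomputable def occupancy (M : MDP S A) (π : Policy n S A) (θ : EuclideanSpace ℝ (Fin n))
    (γ : ℝ) (x : S × A) : ℝ :=
  if γ < 1 then (1 - γ) * ∑' t : ℕ, γ ^ t * pairProb M π θ t x
  else limUnder atTop fun T : ℕ => (1 / (T : ℝ)) * ∑ t ∈ Finset.range (T + 1), pairProb M π θ t x

/-- The probability of `((s, a), (s', a'))` when `(s, a)` has the occupancy distribution,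
`s' ∼ P(· | s, a)` and `a' ∼ π_θ(· | s')`. -/
noncomputable def sampleProb (M : MDP S A) (π : Policy n S A) (θ : EuclideanSpace ℝ (Fin n))
    (γ : ℝ) (z : (S × A) × (S × A)) : ℝ :=
  occupancy M π θ γ z.1 * M.trans z.1.1 z.1.2 z.2.1 * π.prob θ z.2.1 z.2.2

/-- The expectation `E_p` of a matrix-valued function of a sample `((s, a), (s', a'))`. -/
noncomputable def sampleMean (M : MDP S A) (π : Policy n S A) (θ : EuclideanSpace ℝ (Fin n))
    (γ : ℝ) {I J : Type*} (F : (S × A) × (S × A) → Matrix I J ℝ) : Matrix I J ℝ :=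
  ∑ z, sampleProb M π θ γ z • F z

/-- The score `∇_θ log π_θ(a | s)` as a vector of coordinates. -/
noncomputable def score (π : Policy n S A) (θ : EuclideanSpace ℝ (Fin n)) (x : S × A) :
    Fin n → ℝ :=
  fun k => gradient (fun ϑ => Real.log (π.prob ϑ x.1 x.2)) θ k

end Chain

section Updates

variable {S A : Type*} [Fintype A] {n d : ℕ}

/-- The feature matrix: row `i` is the `i`-th feature as a function of the state-action pair,
and the column at `(s, a)` is the feature vector `Φ(s, a)`. -/
def featureMatrix (Φ : S × A → Fin d → ℝ) : Matrix (Fin d) (S × A) ℝ :=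
  Matrix.of fun i x => Φ x i

/-- `δ = Φ Φᵀ - γ Φ Φ'ᵀ`, also written `A_t`. -/
def sampleA (Φ : S × A → Fin d → ℝ) (γ : ℝ) (z : (S × A) × (S × A)) :
    Matrix (Fin d) (Fin d) ℝ :=
  Matrix.vecMulVec (Φ z.1) (Φ z.1) - γ • Matrix.vecMulVec (Φ z.1) (Φ z.2)

/-- `B_t = Φ gᵀ`. -/
noncomputable def sampleB (π : Policy n S A) (θ : EuclideanSpace ℝ (Fin n))
    (Φ : S × A → Fin d → ℝ) (z : (S × A) × (S × A)) : Matrix (Fin d) (Fin n) ℝ :=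
  Matrix.vecMulVec (Φ z.1) (score π θ z.1)

/-- `C_t = Φ Φᵀ`. -/
def sampleC (Φ : S × A → Fin d → ℝ) (z : (S × A) × (S × A)) : Matrix (Fin d) (Fin d) ℝ :=
  Matrix.vecMulVec (Φ z.1) (Φ z.1)

/-- The iterates: primal weights `α`, dual weights `β`, and the multiplier `τ`. -/
structure Params (d n : ℕ) where
  α : Matrix (Fin d) (Fin n) ℝ
  β : Matrix (Fin d) (Fin n) ℝ
  τ : Fin n → ℝ

/-- One stochastic gradient descent (in `α`) and ascent (in `β`, `τ`) step of size `ε`. -/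
noncomputable def step (π : Policy n S A) (θ : EuclideanSpace ℝ (Fin n)) (Φ : S × A → Fin d → ℝ)
    (γ l ε : ℝ) (z : (S × A) × (S × A)) (p : Params d n) : Params d n where
  α := p.α - ε • (sampleA Φ γ z * p.β + l • Matrix.vecMulVec (Φ z.1) p.τ)
  β := p.β + ε • ((sampleA Φ γ z).transpose * p.α - sampleB π θ Φ z - sampleC Φ z * p.β)
  τ := p.τ + ε • (l • (p.α.transpose.mulVec (Φ z.1) - p.τ))

/-- The iterates of the min-max algorithm along a sequence of samples. -/
noncomputable def iterate (π : Policy n S A) (θ : EuclideanSpace ℝ (Fin n))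
    (Φ : S × A → Fin d → ℝ) (γ l : ℝ) (ε : ℕ → ℝ) (z : ℕ → (S × A) × (S × A))
    (p₀ : Params d n) : ℕ → Params d n
  | 0 => p₀
  | t + 1 => step π θ Φ γ l (ε t) (z t) (iterate π θ Φ γ l ε z p₀ t)

/-- The stacked matrix `[α; β]`. -/
def Params.stackTwo (p : Params d n) : Matrix (Fin d ⊕ Fin d) (Fin n) ℝ :=
  Matrix.fromRows p.α p.β

/-- The stacked matrix `[α; β; τᵀ]`. -/
def Params.stack (p : Params d n) : Matrix ((Fin d ⊕ Fin d) ⊕ Unit) (Fin n) ℝ :=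
  Matrix.fromRows p.stackTwo (Matrix.replicateRow Unit p.τ)

/-- The block `[[0, -A_t], [A_tᵀ, -C_t]]`. -/
def sampleGTwo (Φ : S × A → Fin d → ℝ) (γ : ℝ) (z : (S × A) × (S × A)) :
    Matrix (Fin d ⊕ Fin d) (Fin d ⊕ Fin d) ℝ :=
  Matrix.fromBlocks 0 (-sampleA Φ γ z) (sampleA Φ γ z).transpose (-sampleC Φ z)

/-- The matrix `[[0, -A_t, -l Φ_t], [A_tᵀ, -C_t, 0], [l Φ_tᵀ, 0, -l]]`. -/
def sampleG (Φ : S × A → Fin d → ℝ) (γ l : ℝ) (z : (S × A) × (S × A)) :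
    Matrix ((Fin d ⊕ Fin d) ⊕ Unit) ((Fin d ⊕ Fin d) ⊕ Unit) ℝ :=
  Matrix.fromBlocks (sampleGTwo Φ γ z)
    (Matrix.fromRows (Matrix.replicateCol Unit (-(l • Φ z.1))) 0)
    (Matrix.fromCols (Matrix.replicateRow Unit (l • Φ z.1)) 0)
    (-(l • (1 : Matrix Unit Unit ℝ)))

/-- The matrix `[0; -B_t]`. -/
noncomputable def sampleHTwo (π : Policy n S A) (θ : EuclideanSpace ℝ (Fin n))
    (Φ : S × A → Fin d → ℝ) (z : (S × A) × (S × A)) : Matrix (Fin d ⊕ Fin d) (Fin n) ℝ :=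
  Matrix.fromRows 0 (-sampleB π θ Φ z)

/-- The matrix `[0; -B_t; 0]`. -/
noncomputable def sampleH (π : Policy n S A) (θ : EuclideanSpace ℝ (Fin n))
    (Φ : S × A → Fin d → ℝ) (z : (S × A) × (S × A)) :
    Matrix ((Fin d ⊕ Fin d) ⊕ Unit) (Fin n) ℝ :=
  Matrix.fromRows (sampleHTwo π θ Φ z) 0

/-- Sanity check: the updates are the linear recursion `d_{t+1} = d_t + ε (G_{t+1} d_t + h_{t+1})`. -/
theorem stack_step (π : Policy n S A) (θ : EuclideanSpace ℝ (Fin n)) (Φ : S × A → Fin d → ℝ)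
    (γ l ε : ℝ) (z : (S × A) × (S × A)) (p : Params d n) :
    (step π θ Φ γ l ε z p).stack =
      p.stack + ε • (sampleG Φ γ l z * p.stack + sampleH π θ Φ z) := by
  ext i k
  rcases i with (i | i) | i
  · simp [step, Params.stack, Params.stackTwo, sampleG, sampleGTwo, sampleH, sampleHTwo,
      Matrix.mul_apply, Matrix.vecMulVec_apply]
    ring
  · simp [step, Params.stack, Params.stackTwo, sampleG, sampleGTwo, sampleH, sampleHTwo,
      Matrix.mul_apply]
    ring
  · simp [step, Params.stack, Params.stackTwo, sampleG, sampleGTwo, sampleH, sampleHTwo,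
      Matrix.mul_apply, Matrix.mulVec, dotProduct, mul_sub, mul_add, Finset.mul_sum]
    rw [sub_eq_add_neg]
    congr 1
    exact Finset.sum_congr rfl fun _ _ => by ring

end Updates

end LogDensityGradient

/-!
The stacked iterates follow a linear recursion `W ↦ W + ε (H z W + b z)` driven by independent
samples, so convergence reduces to the stability of the mean matrix `G = E[H]`, in the form of a
quadratic Lyapunov function `V w = wᵀ P w` with `wᵀ P G w < 0`.

Convergence (`tendstoInMeasure_of_hasLyapunov`). The error `W - W*`, column by column, is driven by
centred noise that is independent of the past. Taking expectations, `u t = E[V (error)]` satisfies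
`u (t + 1) ≤ (1 - c ε t + C ε t ^ 2) u t + C ε t ^ 2` (`exists_lyapunov_drift`), which forces `u`
to zero for Robbins–Monro steps (`tendsto_zero_of_robbinsMonro`). Convergence in probability is
then Markov's inequality; no martingale argument is needed.

Stability (`HasLyapunov.saddle`). After regrouping the blocks, `G = [[0, -N], [Nᵀ, -D]]` with
`D = diag (E[C_t], l)` and `N = [E[A_t], l E[Φ_t]]` (without the last column if `l = 0`). The
energy `|w|²` only dissipates in the second block, where `D` is positive definite, but the cross
term `-xᵀ N y` decreases in the first one as soon as `Nᵀ` is injective. Hence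
`|w|² - 2 δ xᵀ N y` is a Lyapunov function for small `δ > 0`.

The chain (`eq_zero_of_sum_sampleProb_mul_eq_zero`). The occupancy distribution `d` solves the flow
equation `d = (1 - γ) d₀ + γ d P` and is positive everywhere, so `E[C_t]` is positive definite. For
`γ = 1` this uses that time averages converge, by compactness and uniqueness of the stationary
distribution. The flow equation turns `xᵀ E[A_t] x` into a Dirichlet form of `f = Φᵀ x`: it
vanishes only for `f = 0` if `γ < 1`, and only for constant `f` if `γ = 1`. In both cases a vector
in the kernel of `E[A_t]ᵀ` with `E[f] = 0` is zero, which is the injectivity of `Nᵀ` for `l > 0`.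
-/

namespace LogDensityGradient

/-! ### A Robbins–Monro recursion for real sequences -/

/-- The deterministic core of stochastic approximation: a nonnegative sequence which contracts at
rate `c ε t` up to errors of order `ε t ^ 2` vanishes in the limit. -/
theorem tendsto_zero_of_robbinsMonro {u ε : ℕ → ℝ} {c K : ℝ} (hc : 0 < c) (hK : 0 ≤ K)
    (hu : ∀ t, 0 ≤ u t) (hε : ∀ t, 0 ≤ ε t) (hε1 : ¬ Summable ε)
    (hε2 : Summable fun t => ε t ^ 2)
    (h : ∀ t, u (t + 1) ≤ (1 - c * ε t + K * ε t ^ 2) * u t + K * ε t ^ 2) :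
    Tendsto u atTop (𝓝 0) := by
  obtain ⟨N, hN⟩ : ∃ N, ∀ t ≥ N, K * ε t ≤ c / 2 := by
    have h0 : (0 : ℝ) < (c / (2 * (K + 1))) ^ 2 := by positivity
    obtain ⟨N, hN⟩ := eventually_atTop.1 (hε2.tendsto_atTop_zero.eventually (gt_mem_nhds h0))
    refine ⟨N, fun t ht => ?_⟩
    have h1 : ε t < c / (2 * (K + 1)) := lt_of_pow_lt_pow_left₀ 2 (by positivity) (hN t ht)
    have h2 : (K + 1) * ε t < c / 2 := by
      rw [lt_div_iff₀ (by positivity)] at h1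
      linarith
    nlinarith [hε t]
  -- adding the tail `K ∑_{s ≥ t} ε s ^ 2` to `u t` makes the sequence decreasing
  set L := ∑' t, ε t ^ 2
  set r : ℕ → ℝ := fun t => K * (L - ∑ s ∈ Finset.range (t + N), ε s ^ 2) with hr
  set v : ℕ → ℝ := fun t => u (t + N) + r t with hv
  have hr0 : ∀ t, 0 ≤ r t := fun t =>
    mul_nonneg hK (sub_nonneg.2 (hε2.sum_le_tsum _ fun _ _ => sq_nonneg _))
  have hrlim : Tendsto r atTop (𝓝 0) := by
    have := ((tendsto_add_atTop_iff_nat N).2 hε2.hasSum.tendsto_sum_nat).const_sub L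
    simpa [hr, L] using this.const_mul K
  have hstep : ∀ t, v (t + 1) ≤ v t - c / 2 * (ε (t + N) * u (t + N)) := by
    intro t
    have h1 := h (t + N)
    have h2 := hN (t + N) (by omega)
    have h3 : K * ε (t + N) ^ 2 * u (t + N) ≤ c / 2 * (ε (t + N) * u (t + N)) := by
      have := mul_le_mul_of_nonneg_right h2 (mul_nonneg (hε (t + N)) (hu (t + N)))
      linarith
    simp only [hv, hr, show t + 1 + N = t + N + 1 by omega, Finset.sum_range_succ]
    linarith
  have hv0 : ∀ t, 0 ≤ v t := fun t => add_nonneg (hu _) (hr0 t)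
  have hanti : Antitone v := antitone_nat_of_succ_le fun t =>
    (hstep t).trans (sub_le_self _ (by have := mul_nonneg (hε (t + N)) (hu (t + N)); positivity))
  have hvlim := tendsto_atTop_ciInf hanti ⟨0, by rintro _ ⟨t, rfl⟩; exact hv0 t⟩
  set a := ⨅ t, v t
  have hulim : Tendsto (fun t => u (t + N)) atTop (𝓝 a) := by
    simpa [hv] using hvlim.sub hrlim
  have ha : 0 ≤ a := ge_of_tendsto' hulim fun t => hu _
  rcases ha.eq_or_lt with ha | ha
  · rw [ha]
    exact (tendsto_add_atTop_iff_nat N).1 hulim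
  -- a positive limit would make `ε` summable
  refine absurd ?_ hε1
  have hs : Summable fun t => ε (t + N) * u (t + N) := by
    refine summable_of_sum_range_le (c := v 0 / (c / 2))
      (fun t => mul_nonneg (hε _) (hu _)) fun T => ?_
    rw [le_div_iff₀ (by positivity), Finset.sum_mul]
    have : ∑ t ∈ Finset.range T, ε (t + N) * u (t + N) * (c / 2) ≤ v 0 - v T := by
      rw [← Finset.sum_range_sub']
      exact Finset.sum_le_sum fun t _ => by linarith [hstep t]
    linarith [hv0 T]
  refine (summable_nat_add_iff N).1 ?_
  refine (hs.mul_left (2 / a)).of_norm_bounded_eventually_nat ?_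
  filter_upwards [hulim.eventually (lt_mem_nhds (half_lt_self ha))] with t ht
  rw [Real.norm_of_nonneg (hε _)]
  calc ε (t + N) = 2 / a * (ε (t + N) * (a / 2)) := by field_simp
    _ ≤ 2 / a * (ε (t + N) * u (t + N)) := by have := hε (t + N); gcongr

/-! ### Quadratic Lyapunov functions -/

section Lyapunov

open Matrix

variable {I J : Type*} [Fintype I] [Fintype J]

/-- Finsler's lemma for continuous functions that are homogeneous of degree two: if `R` is
negative wherever the nonnegative form `Q` vanishes, then `δ R < Q` for all small `δ > 0`. -/
theorem exists_forall_mul_lt_of_homogeneous {Q R : (I → ℝ) → ℝ} (hQ : Continuous Q)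
    (hR : Continuous R) (hQ2 : ∀ (a : ℝ) w, Q (a • w) = a ^ 2 * Q w)
    (hR2 : ∀ (a : ℝ) w, R (a • w) = a ^ 2 * R w) (hQ0 : ∀ w, 0 ≤ Q w)
    (hQR : ∀ w, w ≠ 0 → Q w = 0 → R w < 0) :
    ∃ δ₀ > 0, ∀ δ, 0 < δ → δ ≤ δ₀ → ∀ w, w ≠ 0 → δ * R w < Q w := by
  suffices hsphere : ∃ δ₀ > 0, ∀ δ, 0 < δ → δ ≤ δ₀ → ∀ w ∈ Metric.sphere (0 : I → ℝ) 1,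
      δ * R w < Q w by
    obtain ⟨δ₀, hδ₀, h⟩ := hsphere
    refine ⟨δ₀, hδ₀, fun δ h0 h1 w hw => ?_⟩
    have hw' : 0 < ‖w‖ := norm_pos_iff.2 hw
    have := h δ h0 h1 (‖w‖⁻¹ • w) (by simp [norm_smul, hw'.ne'])
    rw [hQ2, hR2, mul_left_comm] at this
    exact lt_of_mul_lt_mul_left this (by positivity)
  set T := Metric.sphere (0 : I → ℝ) 1 ∩ {w | 0 ≤ R w} with hT
  have hTc : IsCompact T := (isCompact_sphere _ _).inter_right (isClosed_le continuous_const hR)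
  have hne : ∀ w ∈ Metric.sphere (0 : I → ℝ) 1, w ≠ 0 := by
    rintro w hw rfl
    simp at hw
  rcases T.eq_empty_or_nonempty with hTe | hTn
  · refine ⟨1, one_pos, fun δ h0 _ w hw => ?_⟩
    have hRw : R w < 0 := by
      by_contra! hRw
      exact (hTe ▸ (⟨hw, hRw⟩ : w ∈ T) : w ∈ (∅ : Set (I → ℝ)))
    exact (mul_neg_of_pos_of_neg h0 hRw).trans_le (hQ0 w)
  obtain ⟨w₀, hw₀, hmin⟩ := hTc.exists_isMinOn hTn hQ.continuousOn
  obtain ⟨w₁, hw₁, hmax⟩ := hTc.exists_isMaxOn hTn hR.continuousOn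
  have hq : 0 < Q w₀ := (hQ0 w₀).lt_of_ne fun h =>
    (hQR w₀ (hne _ hw₀.1) h.symm).not_ge hw₀.2
  have hr : 0 ≤ R w₁ := hw₁.2
  refine ⟨Q w₀ / (R w₁ + 1), by positivity, fun δ h0 h1 w hw => ?_⟩
  rcases lt_or_ge (R w) 0 with hRw | hRw
  · exact (mul_neg_of_pos_of_neg h0 hRw).trans_le (hQ0 w)
  · have h2 : R w ≤ R w₁ := hmax ⟨hw, hRw⟩
    have h3 : Q w₀ ≤ Q w := hmin ⟨hw, hRw⟩
    rw [le_div_iff₀ (by positivity)] at h1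
    nlinarith

/-- A real square matrix `G` has a quadratic Lyapunov function if some symmetric positive definite
`P` satisfies `wᵀ P G w < 0` for all `w ≠ 0`, so that `w ↦ wᵀ P w` decreases along `w' = G w`. -/
def HasLyapunov (G : Matrix I I ℝ) : Prop :=
  ∃ P : Matrix I I ℝ, P.IsSymm ∧ (∀ w, w ≠ 0 → 0 < w ⬝ᵥ P *ᵥ w) ∧
    ∀ w, w ≠ 0 → w ⬝ᵥ P *ᵥ (G *ᵥ w) < 0

theorem HasLyapunov.isUnit_det [DecidableEq I] {G : Matrix I I ℝ} (hG : HasLyapunov G) :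
    IsUnit G.det := by
  obtain ⟨P, -, -, h⟩ := hG
  rw [isUnit_iff_ne_zero]
  intro h0
  obtain ⟨w, hw, hGw⟩ := exists_mulVec_eq_zero_iff.2 h0
  simpa [hGw] using h w hw

theorem HasLyapunov.submatrix {G : Matrix I I ℝ} (hG : HasLyapunov G) (e : J ≃ I) :
    HasLyapunov (G.submatrix e e) := by
  obtain ⟨P, hP, h0, h1⟩ := hG
  have key : ∀ (B : Matrix I I ℝ) (w : J → ℝ),
      B.submatrix e e *ᵥ w = (B *ᵥ (w ∘ e.symm)) ∘ e := fun B w => submatrix_mulVec_equiv _ _ _ _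
  have hdot : ∀ (u : J → ℝ) (v : I → ℝ), u ⬝ᵥ (v ∘ e) = (u ∘ e.symm) ⬝ᵥ v := fun u v => by
    simp [dotProduct, ← e.sum_comp]
  have hne : ∀ w : J → ℝ, w ≠ 0 → w ∘ e.symm ≠ 0 := fun w hw h => hw <| by
    ext j
    simpa using congrFun h (e j)
  refine ⟨P.submatrix e e, hP.submatrix _, fun w hw => ?_, fun w hw => ?_⟩
  · rw [key, hdot]
    exact h0 _ (hne w hw)
  · rw [key, key, hdot]
    simpa [Function.comp_assoc] using h1 _ (hne w hw)

/-- A strict Lyapunov function from the weak one `wᵀ w`: if `wᵀ G w ≤ 0`, and the derivative of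
the cross term `wᵀ K w` along `w' = G w` is negative wherever `wᵀ G w = 0`, then
`wᵀ w + 2 δ wᵀ K w` is a Lyapunov function for all small `δ > 0`. -/
theorem HasLyapunov.of_cross_term {G : Matrix I I ℝ} (K : Matrix I I ℝ)
    (hG : ∀ w, w ⬝ᵥ G *ᵥ w ≤ 0)
    (hK : ∀ w, w ≠ 0 → w ⬝ᵥ G *ᵥ w = 0 →
      (G *ᵥ w) ⬝ᵥ (K *ᵥ w) + w ⬝ᵥ K *ᵥ (G *ᵥ w) < 0) : HasLyapunov G := by
  classical
  obtain ⟨δ₁, hδ₁, h₁⟩ := exists_forall_mul_lt_of_homogeneous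
    (Q := fun w : I → ℝ => -(w ⬝ᵥ G *ᵥ w))
    (R := fun w => (G *ᵥ w) ⬝ᵥ (K *ᵥ w) + w ⬝ᵥ K *ᵥ (G *ᵥ w))
    (by fun_prop) (by fun_prop)
    (fun a w => by simp [mulVec_smul]; ring) (fun a w => by simp [mulVec_smul]; ring)
    (fun w => by simpa using hG w) (fun w hw h => hK w hw (by simpa using h))
  obtain ⟨δ₂, hδ₂, h₂⟩ := exists_forall_mul_lt_of_homogeneous
    (Q := fun w : I → ℝ => w ⬝ᵥ w) (R := fun w => -(2 * (w ⬝ᵥ K *ᵥ w)))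
    (by fun_prop) (by fun_prop)
    (fun a w => by simp; ring) (fun a w => by simp [mulVec_smul]; ring)
    (fun w => by simpa using dotProduct_self_star_nonneg w)
    (fun w hw h => absurd (dotProduct_self_eq_zero.1 h) hw)
  set δ := min δ₁ δ₂
  have hδ : 0 < δ := lt_min hδ₁ hδ₂
  have hKT : ∀ u v : I → ℝ, u ⬝ᵥ Kᵀ *ᵥ v = v ⬝ᵥ K *ᵥ u := fun u v => by
    rw [mulVec_transpose, dotProduct_comm, dotProduct_mulVec]
  refine ⟨1 + δ • (K + Kᵀ), ?_, fun w hw => ?_, fun w hw => ?_⟩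
  · simp [IsSymm, add_comm]
  · have := h₂ δ hδ (min_le_right _ _) w hw
    simp only [add_mulVec, one_mulVec, smul_mulVec, dotProduct_add, dotProduct_smul, hKT,
      smul_eq_mul]
    linarith
  · have := h₁ δ hδ (min_le_left _ _) w hw
    simp only [add_mulVec, one_mulVec, smul_mulVec, dotProduct_add, dotProduct_smul, hKT,
      smul_eq_mul]
    linarith

/-- A saddle-point matrix `[[0, -N], [Nᵀ, -D]]` with `D` positive definite and `Nᵀ` injective
has a Lyapunov function, although its quadratic form vanishes on the whole first block. -/
theorem HasLyapunov.saddle {N : Matrix I J ℝ} {D : Matrix J J ℝ}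
    (hN : ∀ x, Nᵀ *ᵥ x = 0 → x = 0) (hD : ∀ y, y ≠ 0 → 0 < y ⬝ᵥ D *ᵥ y) :
    HasLyapunov (fromBlocks 0 (-N) Nᵀ (-D)) := by
  have hquad : ∀ w : I ⊕ J → ℝ, w ⬝ᵥ fromBlocks 0 (-N) Nᵀ (-D) *ᵥ w =
      -((w ∘ Sum.inr) ⬝ᵥ D *ᵥ (w ∘ Sum.inr)) := fun w => by
    obtain ⟨x, y, rfl⟩ : ∃ x y, w = Sum.elim x y := ⟨_, _, (Sum.elim_comp_inl_inr w).symm⟩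
    have : y ⬝ᵥ Nᵀ *ᵥ x = x ⬝ᵥ N *ᵥ y := by
      rw [mulVec_transpose, dotProduct_comm, dotProduct_mulVec]
    simp [fromBlocks_mulVec, sumElim_dotProduct_sumElim, neg_mulVec, this]
  refine HasLyapunov.of_cross_term (fromBlocks 0 (-N) 0 0) (fun w => ?_) fun w hw h => ?_
  · rw [hquad, neg_nonpos]
    rcases eq_or_ne (w ∘ Sum.inr) 0 with h0 | h0
    · simp [h0]
    · exact (hD _ h0).le
  · rw [hquad, neg_eq_zero] at h
    obtain ⟨x, y, rfl⟩ : ∃ x y, w = Sum.elim x y := ⟨_, _, (Sum.elim_comp_inl_inr w).symm⟩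
    have hy : y = 0 := by
      by_contra hy
      exact (hD y hy).ne' (by simpa using h)
    subst hy
    have hx : Nᵀ *ᵥ x ≠ 0 := fun hx => hw (by simp [hN x hx])
    have hpos : 0 < (Nᵀ *ᵥ x) ⬝ᵥ (Nᵀ *ᵥ x) :=
      (by simpa using dotProduct_self_star_nonneg (Nᵀ *ᵥ x) : (0 : ℝ) ≤ _).lt_of_ne
        fun h => hx (dotProduct_self_eq_zero.1 h.symm)
    have hxN : x ⬝ᵥ N *ᵥ (Nᵀ *ᵥ x) = (Nᵀ *ᵥ x) ⬝ᵥ (Nᵀ *ᵥ x) := by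
      rw [dotProduct_mulVec, ← mulVec_transpose]
    simp [fromBlocks_mulVec, sumElim_dotProduct_sumElim, neg_mulVec, hxN, hpos,
      -mulVec_mulVec]

end Lyapunov

/-! ### Linear stochastic approximation with independent finite-valued noise -/

/-- A recursively defined process depends only on the noise before the present time. -/
theorem exists_eq_comp_restrict {Ω X W : Type*} {z : ℕ → Ω → X} {w : ℕ → Ω → W}
    (T : ℕ → X → W → W) (w₀ : W) (hw₀ : ∀ ω, w 0 ω = w₀)
    (hw : ∀ t ω, w (t + 1) ω = T t (z t ω) (w t ω)) (t : ℕ) :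
    ∃ f : (Finset.range t → X) → W, ∀ ω, w t ω = f fun i => z i ω := by
  induction t with
  | zero => exact ⟨fun _ => w₀, hw₀⟩
  | succ t ih =>
    obtain ⟨f, hf⟩ := ih
    refine ⟨fun y => T t (y ⟨t, by simp⟩)
      (f fun i => y ⟨i, Finset.mem_range.2 ((Finset.mem_range.1 i.2).trans t.lt_succ_self)⟩),
      fun ω => ?_⟩
    rw [hw, hf]

section Approximation

open Matrix

variable {I K X : Type*} [Fintype I] [Fintype K] [Fintype X]

/-- The mean one-step change of the Lyapunov function `w ↦ wᵀ P w` along the noisy linear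
recursion `w ↦ w + ε (H x w + e x)` with centred `e` and Lyapunov-stable mean of `H`. -/
theorem exists_lyapunov_drift {p : X → ℝ} (hp : ∀ x, 0 ≤ p x) (hp1 : ∑ x, p x = 1)
    (H : X → Matrix I I ℝ) {P : Matrix I I ℝ} (hP : P.IsSymm)
    (hpos : ∀ w, w ≠ 0 → 0 < w ⬝ᵥ P *ᵥ w)
    (hneg : ∀ w, w ≠ 0 → w ⬝ᵥ P *ᵥ ((∑ x, p x • H x) *ᵥ w) < 0)
    (e : X → I → ℝ) (he : ∑ x, p x • e x = 0) :
    ∃ c > 0, ∃ C ≥ 0, ∀ ε, 0 ≤ ε → ∀ w : I → ℝ,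
      ∑ x, p x * ((w + ε • (H x *ᵥ w + e x)) ⬝ᵥ P *ᵥ (w + ε • (H x *ᵥ w + e x))) ≤
        (1 - c * ε + C * ε ^ 2) * (w ⬝ᵥ P *ᵥ w) + C * ε ^ 2 := by
  have hpos' : ∀ w, 0 ≤ w ⬝ᵥ P *ᵥ w := fun w => by
    rcases eq_or_ne w 0 with rfl | hw
    · simp
    · exact (hpos w hw).le
  have hsymm : ∀ u v, u ⬝ᵥ P *ᵥ v = v ⬝ᵥ P *ᵥ u := fun u v => by
    conv_lhs => rw [← hP.eq]
    rw [mulVec_transpose, dotProduct_comm, dotProduct_mulVec]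
  -- comparison of the drift, and of the mean squared noise, with the Lyapunov function
  obtain ⟨c, hc, hcV⟩ := exists_forall_mul_lt_of_homogeneous
    (Q := fun w => -(w ⬝ᵥ P *ᵥ ((∑ x, p x • H x) *ᵥ w))) (R := fun w => w ⬝ᵥ P *ᵥ w)
    (by fun_prop) (by fun_prop)
    (fun a w => by simp [mulVec_smul]; ring) (fun a w => by simp [mulVec_smul]; ring)
    (fun w => by
      rcases eq_or_ne w 0 with rfl | hw
      · simp
      · simpa using (hneg w hw).le)
    (fun w hw h => absurd h (by simpa using (hneg w hw).ne))
  obtain ⟨b, hb, hbV⟩ := exists_forall_mul_lt_of_homogeneous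
    (Q := fun w => w ⬝ᵥ P *ᵥ w) (R := fun w => ∑ x, p x * ((H x *ᵥ w) ⬝ᵥ P *ᵥ (H x *ᵥ w)))
    (by fun_prop) (by fun_prop)
    (fun a w => by simp [mulVec_smul]; ring)
    (fun a w => by
      rw [Finset.mul_sum]
      exact Finset.sum_congr rfl fun x _ => by simp [mulVec_smul]; ring)
    hpos' (fun w hw h => absurd h (hpos w hw).ne')
  have hdrift : ∀ w, w ⬝ᵥ P *ᵥ ((∑ x, p x • H x) *ᵥ w) ≤ -c * (w ⬝ᵥ P *ᵥ w) := fun w => by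
    rcases eq_or_ne w 0 with rfl | hw
    · simp
    · linarith [hcV c hc le_rfl w hw]
  have hnoise : ∀ w, ∑ x, p x * ((H x *ᵥ w) ⬝ᵥ P *ᵥ (H x *ᵥ w)) ≤ b⁻¹ * (w ⬝ᵥ P *ᵥ w) :=
    fun w => by
      rcases eq_or_ne w 0 with rfl | hw
      · simp
      · rw [le_inv_mul_iff₀ hb]
        exact (hbV b hb le_rfl w hw).le
  set E := ∑ x, p x * (e x ⬝ᵥ P *ᵥ e x)
  have hE : 0 ≤ E := Finset.sum_nonneg fun x _ => mul_nonneg (hp x) (hpos' _)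
  refine ⟨2 * c, by positivity, 2 * b⁻¹ + 2 * E, by positivity, fun ε hε w => ?_⟩
  have hexpand : ∑ x, p x * ((w + ε • (H x *ᵥ w + e x)) ⬝ᵥ P *ᵥ (w + ε • (H x *ᵥ w + e x))) =
      w ⬝ᵥ P *ᵥ w + 2 * ε * (w ⬝ᵥ P *ᵥ ((∑ x, p x • H x) *ᵥ w)) +
        ε ^ 2 * ∑ x, p x * ((H x *ᵥ w + e x) ⬝ᵥ P *ᵥ (H x *ᵥ w + e x)) := by
    have hmean : (∑ x, p x • H x) *ᵥ w = ∑ x, p x • (H x *ᵥ w + e x) := by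
      simp only [smul_add, Finset.sum_add_distrib, he, add_zero, sum_mulVec, smul_mulVec]
    have hone : w ⬝ᵥ P *ᵥ w = ∑ x, p x * (w ⬝ᵥ P *ᵥ w) := by rw [← Finset.sum_mul, hp1, one_mul]
    rw [hmean, mulVec_sum, dotProduct_sum, Finset.mul_sum, Finset.mul_sum, hone,
      ← Finset.sum_add_distrib, ← Finset.sum_add_distrib]
    refine Finset.sum_congr rfl fun x _ => ?_
    set g := H x *ᵥ w + e x
    simp only [mulVec_add, mulVec_smul, dotProduct_add, add_dotProduct, dotProduct_smul,
      smul_dotProduct, smul_eq_mul, hsymm g w]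
    ring
  have hsq : ∑ x, p x * ((H x *ᵥ w + e x) ⬝ᵥ P *ᵥ (H x *ᵥ w + e x)) ≤
      2 * b⁻¹ * (w ⬝ᵥ P *ᵥ w) + 2 * E := by
    have h1 : ∀ x, p x * ((H x *ᵥ w + e x) ⬝ᵥ P *ᵥ (H x *ᵥ w + e x)) ≤
        2 * (p x * ((H x *ᵥ w) ⬝ᵥ P *ᵥ (H x *ᵥ w))) + 2 * (p x * (e x ⬝ᵥ P *ᵥ e x)) := fun x => by
      have h2 := hpos' (H x *ᵥ w - e x)
      have h3 : (H x *ᵥ w + e x) ⬝ᵥ P *ᵥ (H x *ᵥ w + e x) ≤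
          2 * ((H x *ᵥ w) ⬝ᵥ P *ᵥ (H x *ᵥ w)) + 2 * (e x ⬝ᵥ P *ᵥ e x) := by
        simp only [mulVec_sub, mulVec_add, dotProduct_add, add_dotProduct, dotProduct_sub,
          sub_dotProduct] at h2 ⊢
        linarith
      nlinarith [mul_le_mul_of_nonneg_left h3 (hp x)]
    refine (Finset.sum_le_sum fun x _ => h1 x).trans ?_
    rw [Finset.sum_add_distrib, ← Finset.mul_sum, ← Finset.mul_sum]
    linarith [hnoise w]
  rw [hexpand]
  have h1 := mul_le_mul_of_nonneg_left (hdrift w) (by positivity : 0 ≤ 2 * ε)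
  have h2 := mul_le_mul_of_nonneg_left hsq (sq_nonneg ε)
  have h3 : 0 ≤ E * ε ^ 2 * (w ⬝ᵥ P *ᵥ w) := mul_nonneg (by positivity) (hpos' w)
  have h4 : 0 ≤ b⁻¹ * ε ^ 2 := by positivity
  linarith

variable {Ω : Type*} [MeasurableSpace Ω] {μ : Measure Ω} [IsProbabilityMeasure μ]

/-- Integration over independent finite-valued random variables, one coordinate at a time. -/
theorem integral_comp_of_indepFun [MeasurableSpace X] [MeasurableSingletonClass X]
    {Y : Type*} [Finite Y] [MeasurableSpace Y] [MeasurableSingletonClass Y]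
    {U : Ω → Y} {Z : Ω → X} (hU : Measurable U) (hZ : Measurable Z) (hUZ : IndepFun U Z μ)
    (φ : Y → X → ℝ) :
    ∫ ω, φ (U ω) (Z ω) ∂μ = ∑ x, μ.real (Z ⁻¹' {x}) * ∫ ω, φ (U ω) x ∂μ := by
  classical
  have hφ : ∀ x, Measurable fun y => φ y x := fun x => measurable_of_finite _
  have hind : ∀ x : X, Measurable (Set.indicator {x} (1 : X → ℝ)) := fun x => measurable_of_finite _
  have hterm : ∀ x, ∫ ω, φ (U ω) x * Set.indicator {x} (1 : X → ℝ) (Z ω) ∂μ =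
      μ.real (Z ⁻¹' {x}) * ∫ ω, φ (U ω) x ∂μ := fun x => by
    have := (hUZ.comp (hφ x) (hind x)).integral_fun_mul_eq_mul_integral
      ((hφ x).comp hU).aestronglyMeasurable ((hind x).comp hZ).aestronglyMeasurable
    simp only [Function.comp_apply] at this
    rw [this, mul_comm]
    congr 1
    rw [show (fun ω => Set.indicator {x} (1 : X → ℝ) (Z ω)) = (Z ⁻¹' {x}).indicator 1 from rfl,
      integral_indicator_one (hZ (measurableSet_singleton x))]
  rw [← Finset.sum_congr rfl fun x _ => hterm x, ← integral_finsetSum]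
  · refine integral_congr_ae (Eventually.of_forall fun ω => ?_)
    simp [Set.indicator_apply]
  · intro x _
    have : Integrable ((fun q : Y × X => φ q.1 x * Set.indicator {x} (1 : X → ℝ) q.2) ∘
        fun ω => (U ω, Z ω)) μ :=
      (integrable_map_measure (measurable_of_finite _).aestronglyMeasurable
        (hU.prodMk hZ).aemeasurable).1 .of_finite
    exact this

/-- Linear stochastic approximation: if the mean matrix of `W ↦ W + ε (H z W + b z)` has a
Lyapunov function, the iterates converge in probability to the equilibrium. The Lyapunov function
of the error, summed over the columns, has vanishing mean, and Markov's inequality applies. -/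
theorem tendstoInMeasure_of_hasLyapunov [DecidableEq I]
    [MeasurableSpace X] [MeasurableSingletonClass X]
    {p : X → ℝ} {H : X → Matrix I I ℝ} {b : X → Matrix I K ℝ}
    (hG : HasLyapunov (∑ x, p x • H x)) {ε : ℕ → ℝ} (hε : ∀ t, 0 ≤ ε t) (hε1 : ¬ Summable ε)
    (hε2 : Summable fun t => ε t ^ 2) {z : ℕ → Ω → X} (hz : ∀ t, Measurable (z t))
    (hindep : iIndepFun z μ) (hlaw : ∀ t x, μ.real (z t ⁻¹' {x}) = p x)
    {W : ℕ → Ω → Matrix I K ℝ} (W₀ : Matrix I K ℝ) (hW₀ : ∀ ω, W 0 ω = W₀)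
    (hW : ∀ t ω, W (t + 1) ω = W t ω + ε t • (H (z t ω) * W t ω + b (z t ω))) :
    TendstoInMeasure μ W atTop fun _ => -((∑ x, p x • H x)⁻¹ * ∑ x, p x • b x) := by
  set G := ∑ x, p x • H x with hGdef
  set Ws : Matrix I K ℝ := -(G⁻¹ * ∑ x, p x • b x) with hWs
  have hequil : G * Ws + ∑ x, p x • b x = 0 := by
    rw [hWs, Matrix.mul_neg, Matrix.mul_nonsing_inv_cancel_left _ _ hG.isUnit_det, neg_add_cancel]
  obtain ⟨P, hP, hpos, hneg⟩ := hG
  have hpos' : ∀ w, 0 ≤ w ⬝ᵥ P *ᵥ w := fun w => by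
    rcases eq_or_ne w 0 with rfl | hw
    · simp
    · exact (hpos w hw).le
  have hp : ∀ x, 0 ≤ p x := fun x => hlaw 0 x ▸ measureReal_nonneg
  have hp1 : ∑ x, p x = 1 := by
    have := integral_comp_of_indepFun (μ := μ) (U := fun _ => ()) measurable_const (hz 0)
      (indepFun_const_left () _) fun _ _ => 1
    simpa [hlaw] using this.symm
  choose f hf using exists_eq_comp_restrict (fun t x V => V + ε t • (H x * V + b x)) W₀ hW₀ hW
  have hint : ∀ t (φ : Matrix I K ℝ → ℝ), Integrable (fun ω => φ (W t ω)) μ := fun t φ => by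
    have : Integrable ((fun y => φ (f t y)) ∘ fun ω (i : Finset.range t) => z i ω) μ :=
      (integrable_map_measure (measurable_of_finite _).aestronglyMeasurable
        (measurable_pi_lambda _ fun i : Finset.range t => hz i).aemeasurable).1 .of_finite
    simpa [Function.comp_def, ← hf] using this
  have hindepW : ∀ t, IndepFun (fun ω (i : Finset.range t) => z i ω) (z t) μ := fun t => by
    have := hindep.indepFun_finset (Finset.range t) {t} (by simp) hz
    exact this.comp measurable_id (measurable_pi_apply (⟨t, by simp⟩ : ({t} : Finset ℕ)))
  -- the Lyapunov functions of the columns of the error `W t - Ws`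
  set v : ℕ → K → Ω → ℝ := fun t k ω => (W t ω - Ws).col k ⬝ᵥ P *ᵥ (W t ω - Ws).col k with hv
  have hvint : ∀ t k, Integrable (v t k) μ := fun t k =>
    hint t fun V => (V - Ws).col k ⬝ᵥ P *ᵥ (V - Ws).col k
  have hlim : ∀ k, Tendsto (fun t => ∫ ω, v t k ω ∂μ) atTop (𝓝 0) := fun k => by
    have he : ∑ x, p x • (H x * Ws + b x).col k = 0 := by
      ext i
      have := congrFun (congrFun hequil i) k
      simpa [hGdef, Matrix.sum_mul, Matrix.sum_apply, Finset.sum_apply, mul_add,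
        Finset.sum_add_distrib] using this
    obtain ⟨c, hc, C, hC, hdrift⟩ := exists_lyapunov_drift hp hp1 H hP hpos hneg _ he
    refine tendsto_zero_of_robbinsMonro hc hC (fun t => integral_nonneg fun ω => hpos' _)
      hε hε1 hε2 fun t => ?_
    set next : Matrix I K ℝ → X → I → ℝ := fun V x =>
      (V - Ws).col k + ε t • (H x *ᵥ (V - Ws).col k + (H x * Ws + b x).col k) with hnext
    have hcol : ∀ ω, (W (t + 1) ω - Ws).col k = next (W t ω) (z t ω) := fun ω => by
      ext i
      simp only [hnext, hW, col_apply, Matrix.sub_apply, Matrix.add_apply, Matrix.smul_apply,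
        Pi.add_apply, Pi.smul_apply, mulVec, dotProduct, Matrix.mul_apply, mul_sub,
        Finset.sum_sub_distrib, smul_eq_mul]
      ring
    have hsplit : ∫ ω, v (t + 1) k ω ∂μ =
        ∑ x, p x * ∫ ω, next (W t ω) x ⬝ᵥ P *ᵥ next (W t ω) x ∂μ := by
      have := integral_comp_of_indepFun
        (measurable_pi_lambda _ fun i : Finset.range t => hz i) (hz t) (hindepW t)
        fun y x => next (f t y) x ⬝ᵥ P *ᵥ next (f t y) x
      simpa only [hlaw, ← hf, ← hcol] using this
    rw [hsplit]
    simp only [← integral_const_mul]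
    rw [← integral_finsetSum _ fun x _ => hint t fun V => p x * (next V x ⬝ᵥ P *ᵥ next V x)]
    refine (integral_mono (hint t fun V => ∑ x, p x * (next V x ⬝ᵥ P *ᵥ next V x)) ?_
      fun ω => hdrift (ε t) (hε t) _).trans_eq ?_
    · exact ((hvint t k).const_mul _).add (integrable_const _)
    · rw [integral_add ((hvint t k).const_mul _) (integrable_const _), integral_const_mul]
      simp
  obtain ⟨a, ha, haV⟩ := exists_forall_mul_lt_of_homogeneous
    (Q := fun w => w ⬝ᵥ P *ᵥ w) (R := fun w : I → ℝ => w ⬝ᵥ w)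
    (by fun_prop) (by fun_prop) (fun a w => by simp [mulVec_smul]; ring)
    (fun a w => by simp; ring) hpos' (fun w hw h => absurd h (hpos w hw).ne')
  have hnorm : ∀ t ω, a * ‖W t ω - Ws‖ ^ 2 ≤ ∑ k, v t k ω := fun t ω => by
    have hsq : ‖W t ω - Ws‖ ^ 2 = ∑ k, (W t ω - Ws).col k ⬝ᵥ (W t ω - Ws).col k := by
      rw [Matrix.frobenius_norm_def, ← Real.sqrt_eq_rpow, Real.sq_sqrt (by positivity),
        Finset.sum_comm]
      simp [dotProduct, sq]
    rw [hsq, Finset.mul_sum]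
    refine Finset.sum_le_sum fun k _ => ?_
    rcases eq_or_ne ((W t ω - Ws).col k) 0 with h0 | h0
    · simp only [hv, h0, zero_dotProduct, mul_zero, le_refl]
    · exact (haV a ha le_rfl _ h0).le
  rw [tendstoInMeasure_iff_measureReal_norm]
  intro δ hδ
  have hsum : Tendsto (fun t => (∫ ω, ∑ k, v t k ω ∂μ) / (a * δ ^ 2)) atTop (𝓝 0) := by
    simp_rw [fun t => integral_finsetSum (μ := μ) Finset.univ fun k _ => hvint t k]
    simpa using (tendsto_finsetSum _ fun k _ => hlim k).div_const (a * δ ^ 2)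
  refine squeeze_zero (fun t => measureReal_nonneg) (fun t => ?_) hsum
  rw [le_div_iff₀ (by positivity), mul_comm]
  refine le_trans ?_ (mul_meas_ge_le_integral_of_nonneg
    (Eventually.of_forall fun ω => Finset.sum_nonneg fun k _ => hpos' _)
    (integrable_finsetSum _ fun k _ => hvint t k) (a * δ ^ 2))
  refine mul_le_mul_of_nonneg_left (measureReal_mono fun ω hω => ?_) (by positivity)
  have hω' : δ ≤ ‖W t ω - Ws‖ := hω
  exact le_trans (by gcongr) (hnorm t ω)

end Approximation

/-! ### Irreducible Markov chains on a finite set -/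

section Markov

open Matrix

variable {S : Type*}

theorem forall_of_isIrreducible {Q : Matrix S S ℝ} (hQ : Q.IsIrreducible) {T : S → Prop}
    (hT : ∀ i j, T i → 0 < Q i j → T j) {i : S} (hi : T i) (j : S) : T j := by
  let : Quiver S := toQuiver Q
  obtain ⟨p, -⟩ := hQ.connected i j
  induction p with
  | nil => exact hi
  | cons _ e ih => exact hT _ _ ih e.down

variable [Fintype S]

theorem pos_of_isIrreducible {Q : Matrix S S ℝ} (hQ : Q.IsIrreducible) {ν : S → ℝ}
    (hν : ∀ i, 0 ≤ ν i) {c : ℝ} (hc : 0 < c) (hνQ : ∀ j, c * (ν ᵥ* Q) j ≤ ν j)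
    {i : S} (hi : 0 < ν i) (j : S) : 0 < ν j := by
  refine forall_of_isIrreducible hQ (T := fun j => 0 < ν j) (fun i j hi hij => ?_) hi j
  refine lt_of_lt_of_le (mul_pos hc ?_) (hνQ j)
  exact Finset.sum_pos' (fun k _ => mul_nonneg (hν k) (hQ.nonneg k j))
    ⟨i, Finset.mem_univ i, mul_pos hi hij⟩

/-- An irreducible chain has at most one stationary distribution: a stationary signed measure of
total mass zero vanishes, because its absolute value is stationary too, and hence so are its
positive and negative parts. -/
theorem eq_zero_of_vecMul_eq {Q : Matrix S S ℝ} (hQ : Q.IsIrreducible)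
    (hQ1 : ∀ i, ∑ j, Q i j = 1) {ν : S → ℝ} (hν : ν ᵥ* Q = ν) (hν0 : ∑ i, ν i = 0) : ν = 0 := by
  have hle : ∀ j, |ν j| ≤ ((fun i => |ν i|) ᵥ* Q) j := fun j => by
    conv_lhs => rw [← hν]
    refine (Finset.abs_sum_le_sum_abs _ _).trans_eq (Finset.sum_congr rfl fun i _ => ?_)
    rw [abs_mul, abs_of_nonneg (hQ.nonneg i j)]
  have hsum : ∑ j, (((fun i => |ν i|) ᵥ* Q) j - |ν j|) = 0 := by
    rw [Finset.sum_sub_distrib, sub_eq_zero]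
    simp only [vecMul, dotProduct]
    rw [Finset.sum_comm]
    simp [← Finset.mul_sum, hQ1]
  have habs : ∀ j, ((fun i => |ν i|) ᵥ* Q) j = |ν j| := fun j =>
    sub_eq_zero.1 ((Finset.sum_eq_zero_iff_of_nonneg fun j _ => sub_nonneg.2 (hle j)).1 hsum j
      (Finset.mem_univ j))
  have hnonpos : ∀ i, ν i ≤ 0 := by
    by_contra! h
    obtain ⟨i, hi⟩ := h
    have hpos : ∀ j, 0 < |ν j| + ν j := pos_of_isIrreducible hQ (ν := fun j => |ν j| + ν j)
      (fun j => by linarith [neg_abs_le (ν j)]) one_pos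
      (fun j => by
        rw [one_mul, show (fun j => |ν j| + ν j) = (fun j => |ν j|) + ν from rfl, add_vecMul,
          Pi.add_apply, habs, hν])
      (by have := abs_nonneg (ν i); linarith : 0 < |ν i| + ν i)
    have hpos' : ∀ j, 0 < ν j := fun j => by
      by_contra! hj
      have := hpos j
      rw [abs_of_nonpos hj] at this
      linarith
    exact (Finset.sum_pos (fun j _ => hpos' j) ⟨i, Finset.mem_univ i⟩).ne' hν0
  ext i
  exact (Finset.sum_eq_zero_iff_of_nonpos fun i _ => hnonpos i).1 hν0 i (Finset.mem_univ i)

/-- Ergodic theorem in the mean: the time averages of the laws of an irreducible chain on a finite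
set converge to a stationary distribution. -/
theorem exists_tendsto_average {Q : Matrix S S ℝ} (hQ : Q.IsIrreducible)
    (hQ1 : ∀ i, ∑ j, Q i j = 1) {u : ℕ → S → ℝ} (hu : ∀ t, u t ∈ stdSimplex ℝ S)
    (huQ : ∀ t, u (t + 1) = u t ᵥ* Q) :
    ∃ ν ∈ stdSimplex ℝ S, ν ᵥ* Q = ν ∧
      Tendsto (fun T : ℕ => (1 / (T : ℝ)) • ∑ t ∈ Finset.range (T + 1), u t) atTop (𝓝 ν) := by
  set m : ℕ → S → ℝ := fun T => ((T : ℝ) + 1)⁻¹ • ∑ t ∈ Finset.range (T + 1), u t with hm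
  have hmem : ∀ T, m T ∈ stdSimplex ℝ S := fun T => by
    simp only [hm]
    rw [Finset.smul_sum]
    refine (convex_stdSimplex ℝ S).sum_mem (fun _ _ => by positivity) ?_ fun t _ => hu t
    simp
    field_simp
  have hdiff : Tendsto (fun T => m T ᵥ* Q - m T) atTop (𝓝 0) := by
    have hT : ∀ T, m T ᵥ* Q - m T = ((T : ℝ) + 1)⁻¹ • (u (T + 1) - u 0) := fun T => by
      rw [hm, smul_vecMul, ← smul_sub, ← Finset.sum_range_sub, Matrix.sum_vecMul,
        ← Finset.sum_sub_distrib]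
      simp [huQ]
    have hbdd : ∀ T i, |(u (T + 1) - u 0) i| ≤ 1 := fun T i => by
      have h1 := mem_Icc_of_mem_stdSimplex (hu (T + 1)) i
      have h2 := mem_Icc_of_mem_stdSimplex (hu 0) i
      rw [Pi.sub_apply, abs_le]
      constructor <;> linarith [h1.1, h1.2, h2.1, h2.2]
    have hlim : Tendsto (fun T : ℕ => ((T : ℝ) + 1)⁻¹) atTop (𝓝 0) := by
      simpa [one_div] using tendsto_one_div_add_atTop_nhds_zero_nat (𝕜 := ℝ)
    refine tendsto_pi_nhds.2 fun i => squeeze_zero_norm (fun T => ?_) hlim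
    rw [hT, Pi.smul_apply, smul_eq_mul, norm_mul, Real.norm_of_nonneg (by positivity)]
    exact mul_le_of_le_one_right (by positivity) (hbdd T i)
  have hstat : ∀ {φ : ℕ → ℕ} {ν : S → ℝ}, Tendsto φ atTop atTop →
      Tendsto (m ∘ φ) atTop (𝓝 ν) → ν ᵥ* Q = ν := fun {φ ν} hφ hν => by
    have hcont : Continuous fun ν : S → ℝ => ν ᵥ* Q - ν := by fun_prop
    exact sub_eq_zero.1 (tendsto_nhds_unique ((hcont.tendsto ν).comp hν) (hdiff.comp hφ))
  have hcpt : IsCompact (stdSimplex ℝ S) := isCompact_stdSimplex ℝ S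
  obtain ⟨ν, hνmem, φ, hφ, hν⟩ := hcpt.tendsto_subseq hmem
  have hνQ := hstat hφ.tendsto_atTop hν
  refine ⟨ν, hνmem, hνQ, ?_⟩
  have hmlim : Tendsto m atTop (𝓝 ν) := by
    refine tendsto_of_subseq_tendsto fun ns hns => ?_
    obtain ⟨ν', hν'mem, ψ, hψ, hν'⟩ := hcpt.tendsto_subseq fun k => hmem (ns k)
    have hν'Q := hstat (hns.comp hψ.tendsto_atTop) hν'
    have : ν' - ν = 0 := eq_zero_of_vecMul_eq hQ hQ1 (by rw [sub_vecMul, hνQ, hν'Q])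
      (by simp [hνmem.2, hν'mem.2])
    exact ⟨ψ, sub_eq_zero.1 this ▸ hν'⟩
  have hratio : Tendsto (fun T : ℕ => ((T : ℝ) + 1) / T) atTop (𝓝 1) := by
    have h := (tendsto_one_div_atTop_nhds_zero_nat (𝕜 := ℝ)).const_add 1
    rw [add_zero] at h
    refine h.congr' ?_
    filter_upwards [eventually_ne_atTop 0] with T hT
    field_simp
  have := hratio.smul hmlim
  rw [one_smul] at this
  refine this.congr fun T => ?_
  rw [hm, smul_smul]
  congr 1
  field_simp

end Markov

/-! ### The occupancy distribution -/

section Occupancy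

open Matrix

variable {S A : Type*} [Fintype S] [Fintype A] {n : ℕ}
  (M : MDP S A) (π : Policy n S A) (θ : EuclideanSpace ℝ (Fin n))

theorem stateProb_succ (t : ℕ) :
    stateProb M π θ (t + 1) = stateProb M π θ t ᵥ* stateMatrix M π θ := by
  ext j
  simp [stateProb, stateMatrix, vecMul, dotProduct, Finset.mul_sum, mul_assoc]

theorem sum_stateMatrix (i : S) : ∑ j, stateMatrix M π θ i j = 1 := by
  simp only [stateMatrix, of_apply]
  rw [Finset.sum_comm]
  simp [← Finset.mul_sum, M.trans_sum, π.prob_sum]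

theorem stateProb_mem_stdSimplex (t : ℕ) : stateProb M π θ t ∈ stdSimplex ℝ S := by
  induction t with
  | zero => exact ⟨M.init_nonneg, M.init_sum⟩
  | succ t ih =>
    refine ⟨fun j => Finset.sum_nonneg fun i _ => Finset.sum_nonneg fun a _ =>
      mul_nonneg (mul_nonneg (ih.1 i) (π.prob_nonneg θ i a)) (M.trans_nonneg i a j), ?_⟩
    simp only [stateProb_succ, vecMul, dotProduct]
    rw [Finset.sum_comm]
    simp [← Finset.mul_sum, sum_stateMatrix, ih.2]

/-- The occupancy distribution is `ν(s) π(a | s)` for a distribution `ν` on states satisfying the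
flow equation `ν = (1 - γ) d₀ + γ ν Q`, where `Q` is the transition matrix of the states. -/
theorem exists_occupancy_eq {γ : ℝ} (hγ : γ ∈ Set.Icc (0 : ℝ) 1)
    (hirr : (stateMatrix M π θ).IsIrreducible) :
    ∃ ν ∈ stdSimplex ℝ S, (∀ x, occupancy M π θ γ x = ν x.1 * π.prob θ x.1 x.2) ∧
      ∀ j, γ * (ν ᵥ* stateMatrix M π θ) j = ν j - (1 - γ) * M.init j := by
  have hmem := stateProb_mem_stdSimplex M π θ
  rcases hγ.2.lt_or_eq with h1 | rfl
  · have hsummable : ∀ s, Summable fun t => γ ^ t * stateProb M π θ t s := fun s =>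
      (summable_geometric_of_lt_one hγ.1 h1).of_nonneg_of_le
        (fun t => mul_nonneg (pow_nonneg hγ.1 t) ((hmem t).1 s))
        (fun t => mul_le_of_le_one_right (pow_nonneg hγ.1 t)
          (mem_Icc_of_mem_stdSimplex (hmem t) s).2)
    set a : S → ℝ := fun s => ∑' t, γ ^ t * stateProb M π θ t s with ha
    have hflow : ∀ j, γ * (a ᵥ* stateMatrix M π θ) j = a j - M.init j := fun j => by
      have hs1 : HasSum (fun t => γ ^ (t + 1) * stateProb M π θ (t + 1) j) (a j - M.init j) := by
        simpa [stateProb] using (hasSum_nat_add_iff' 1).2 (hsummable j).hasSum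
      have hs2 : HasSum (fun t => γ ^ (t + 1) * stateProb M π θ (t + 1) j)
          (γ * (a ᵥ* stateMatrix M π θ) j) := by
        have := (hasSum_sum fun i (_ : i ∈ Finset.univ) =>
          (hsummable i).hasSum.mul_right (stateMatrix M π θ i j)).mul_left γ
        refine this.congr_fun fun t => ?_
        simp only [stateProb_succ, vecMul, dotProduct, Finset.mul_sum]
        exact Finset.sum_congr rfl fun i _ => by ring
      exact hs2.unique hs1
    have hsum : ∑ s, a s = (1 - γ)⁻¹ := by
      rw [ha, ← Summable.tsum_finsetSum fun s _ => hsummable s, ← tsum_geometric_of_lt_one hγ.1 h1]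
      simp [← Finset.mul_sum, (hmem _).2]
    refine ⟨(1 - γ) • a, ⟨fun s => ?_, ?_⟩, fun x => ?_, fun j => ?_⟩
    · exact mul_nonneg (by linarith) (tsum_nonneg fun t =>
        mul_nonneg (pow_nonneg hγ.1 t) ((hmem t).1 s))
    · simp only [Pi.smul_apply, smul_eq_mul, ← Finset.mul_sum, hsum]
      exact mul_inv_cancel₀ (by linarith)
    · simp only [occupancy, h1, if_true, pairProb, ha, Pi.smul_apply, smul_eq_mul, ← mul_assoc,
        tsum_mul_right]
    · rw [smul_vecMul, Pi.smul_apply, Pi.smul_apply, smul_eq_mul, smul_eq_mul]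
      linear_combination (1 - γ) * hflow j
  · obtain ⟨ν, hν, hνQ, hlim⟩ := exists_tendsto_average hirr (sum_stateMatrix M π θ) hmem
      (stateProb_succ M π θ)
    refine ⟨ν, hν, fun x => ?_, fun j => by simp [hνQ]⟩
    simp only [occupancy, lt_irrefl, if_false, pairProb]
    refine Tendsto.limUnder_eq ?_
    refine ((tendsto_pi_nhds.1 hlim x.1).mul_const (π.prob θ x.1 x.2)).congr fun T => ?_
    simp [Finset.sum_mul, mul_assoc]

variable {M π θ}

theorem occupancy_pos {γ : ℝ} (hγ : γ ∈ Set.Icc (0 : ℝ) 1)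
    (hirr : (stateMatrix M π θ).IsIrreducible) (hπpos : ∀ s a, 0 < π.prob θ s a)
    (hinit : γ = 0 → ∀ s, 0 < M.init s) (x : S × A) : 0 < occupancy M π θ γ x := by
  obtain ⟨ν, hν, hocc, hflow⟩ := exists_occupancy_eq M π θ hγ hirr
  rw [hocc]
  refine mul_pos ?_ (hπpos _ _)
  rcases hγ.1.eq_or_lt with rfl | h0
  · have := hflow x.1
    linarith [hinit rfl x.1]
  obtain ⟨i, -, hi⟩ : ∃ i ∈ Finset.univ, 0 < ν i := Finset.exists_lt_of_sum_lt (by simp [hν.2])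
  refine pos_of_isIrreducible hirr hν.1 h0 (fun j => ?_) hi x.1
  rw [hflow]
  exact sub_le_self _ (mul_nonneg (sub_nonneg.2 hγ.2) (M.init_nonneg j))

theorem sum_sampleProb_mul_fst (γ : ℝ) (g : S × A → ℝ) :
    ∑ z, sampleProb M π θ γ z * g z.1 = ∑ x, occupancy M π θ γ x * g x := by
  rw [Fintype.sum_prod_type]
  refine Finset.sum_congr rfl fun x _ => ?_
  simp only [sampleProb]
  rw [← Finset.sum_mul, Fintype.sum_prod_type]
  simp [← Finset.mul_sum, π.prob_sum, M.trans_sum]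

theorem sum_sampleProb {γ : ℝ} (hγ : γ ∈ Set.Icc (0 : ℝ) 1)
    (hirr : (stateMatrix M π θ).IsIrreducible) : ∑ z, sampleProb M π θ γ z = 1 := by
  obtain ⟨ν, hν, hocc, -⟩ := exists_occupancy_eq M π θ hγ hirr
  have := sum_sampleProb_mul_fst (M := M) (π := π) (θ := θ) γ fun _ => 1
  simp only [mul_one] at this
  rw [this, Fintype.sum_prod_type]
  simp [hocc, ← Finset.mul_sum, π.prob_sum, hν.2]

/-- The flow equation for the law of the successor pair. -/
theorem mul_sum_sampleProb_mul_snd {γ : ℝ} (hγ : γ ∈ Set.Icc (0 : ℝ) 1)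
    (hirr : (stateMatrix M π θ).IsIrreducible) (g : S × A → ℝ) :
    γ * ∑ z, sampleProb M π θ γ z * g z.2 =
      ∑ x, occupancy M π θ γ x * g x - (1 - γ) * ∑ x, pairProb M π θ 0 x * g x := by
  obtain ⟨ν, hν, hocc, hflow⟩ := exists_occupancy_eq M π θ hγ hirr
  rw [Fintype.sum_prod_type, Finset.sum_comm, Finset.mul_sum, Finset.mul_sum,
    ← Finset.sum_sub_distrib]
  refine Finset.sum_congr rfl fun y _ => ?_
  have h : ∑ x : S × A, occupancy M π θ γ x * M.trans x.1 x.2 y.1 =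
      (ν ᵥ* stateMatrix M π θ) y.1 := by
    simp [Fintype.sum_prod_type, hocc, vecMul, dotProduct, stateMatrix, Finset.mul_sum, mul_assoc]
  simp only [sampleProb]
  rw [← Finset.sum_mul, ← Finset.sum_mul, h, hocc]
  simp only [pairProb, stateProb]
  linear_combination (π.prob θ y.1 y.2 * g y) * hflow y.1

/-- The Dirichlet form of the occupancy distribution: the quadratic form of `D (1 - γ P)`, with
`D` the diagonal of the occupancy and `P` the transition matrix of state-action pairs. -/
theorem two_mul_sum_sampleProb_mul {γ : ℝ} (hγ : γ ∈ Set.Icc (0 : ℝ) 1)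
    (hirr : (stateMatrix M π θ).IsIrreducible) (f : S × A → ℝ) :
    2 * ∑ z, sampleProb M π θ γ z * (f z.1 * (f z.1 - γ * f z.2)) =
      (1 - γ) * ∑ x, occupancy M π θ γ x * f x ^ 2 +
      (1 - γ) * ∑ x, pairProb M π θ 0 x * f x ^ 2 +
      γ * ∑ z, sampleProb M π θ γ z * (f z.1 - f z.2) ^ 2 := by
  have h1 := sum_sampleProb_mul_fst (M := M) (π := π) (θ := θ) γ fun x => f x ^ 2
  have h2 := mul_sum_sampleProb_mul_snd hγ hirr fun x => f x ^ 2
  have h3 : 2 * ∑ z, sampleProb M π θ γ z * (f z.1 * (f z.1 - γ * f z.2)) =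
      (2 - γ) * ∑ z, sampleProb M π θ γ z * f z.1 ^ 2 -
      γ * ∑ z, sampleProb M π θ γ z * f z.2 ^ 2 +
      γ * ∑ z, sampleProb M π θ γ z * (f z.1 - f z.2) ^ 2 := by
    simp only [Finset.mul_sum, ← Finset.sum_add_distrib, ← Finset.sum_sub_distrib]
    exact Finset.sum_congr rfl fun z _ => by ring
  rw [h3, h2, h1]
  ring

/-- If the Dirichlet form of `f` vanishes and `f` has mean zero, then `f = 0`. For `γ = 1` the form
only sees differences along transitions, and irreducibility makes `f` constant. -/
theorem eq_zero_of_sum_sampleProb_mul_eq_zero {γ : ℝ} (hγ : γ ∈ Set.Icc (0 : ℝ) 1)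
    (hirr : (stateMatrix M π θ).IsIrreducible) (hπpos : ∀ s a, 0 < π.prob θ s a)
    (hinit : γ = 0 → ∀ s, 0 < M.init s) {f : S × A → ℝ}
    (hf : ∑ z, sampleProb M π θ γ z * (f z.1 * (f z.1 - γ * f z.2)) = 0)
    (hf1 : ∑ z, sampleProb M π θ γ z * f z.1 = 0) (x : S × A) : f x = 0 := by
  have hocc := occupancy_pos hγ hirr hπpos hinit
  have hq : ∀ z, 0 ≤ sampleProb M π θ γ z := fun z =>
    mul_nonneg (mul_nonneg (hocc _).le (M.trans_nonneg _ _ _)) (hπpos _ _).le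
  have hform := two_mul_sum_sampleProb_mul hγ hirr f
  rw [hf, mul_zero] at hform
  have hF1 : 0 ≤ ∑ x, occupancy M π θ γ x * f x ^ 2 :=
    Finset.sum_nonneg fun x _ => mul_nonneg (hocc x).le (sq_nonneg _)
  have hF2 : 0 ≤ ∑ x, pairProb M π θ 0 x * f x ^ 2 := Finset.sum_nonneg fun x _ =>
    mul_nonneg (mul_nonneg (M.init_nonneg _) (hπpos _ _).le) (sq_nonneg _)
  have hF3 : 0 ≤ ∑ z, sampleProb M π θ γ z * (f z.1 - f z.2) ^ 2 :=
    Finset.sum_nonneg fun z _ => mul_nonneg (hq z) (sq_nonneg _)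
  rcases hγ.2.lt_or_eq with h1 | rfl
  · have hzero : ∑ x, occupancy M π θ γ x * f x ^ 2 = 0 := by
      have h2 := mul_nonneg (sub_nonneg.2 h1.le) hF2
      have h3 := mul_nonneg hγ.1 hF3
      have h4 : (1 - γ) * ∑ x, occupancy M π θ γ x * f x ^ 2 ≤ 0 := by linarith
      exact le_antisymm (nonpos_of_mul_nonpos_right h4 (sub_pos.2 h1)) hF1
    have := (Finset.sum_eq_zero_iff_of_nonneg fun x _ =>
      mul_nonneg (hocc x).le (sq_nonneg (f x))).1 hzero x (Finset.mem_univ x)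
    simpa [(hocc x).ne'] using this
  · have hzero : ∑ z, sampleProb M π θ 1 z * (f z.1 - f z.2) ^ 2 = 0 := by linarith
    have hedge : ∀ s a s' a', 0 < M.trans s a s' → f (s', a') = f (s, a) := fun s a s' a' h => by
      have := (Finset.sum_eq_zero_iff_of_nonneg fun z _ =>
        mul_nonneg (hq z) (sq_nonneg (f z.1 - f z.2))).1 hzero ((s, a), (s', a'))
        (Finset.mem_univ _)
      rcases mul_eq_zero.1 this with h0 | h0
      · exact absurd h0 (mul_pos (mul_pos (hocc (s, a)) h) (hπpos s' a')).ne'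
      · exact (sub_eq_zero.1 (pow_eq_zero_iff two_ne_zero |>.1 h0)).symm
    -- the states on which `f` is equal to `f x` for all actions are closed under transitions
    obtain ⟨i, -, hi⟩ : ∃ i ∈ Finset.univ, 0 < M.trans x.1 x.2 i :=
      Finset.exists_lt_of_sum_lt (by simp [M.trans_sum])
    have hconst : ∀ s a, f (s, a) = f x := by
      refine forall_of_isIrreducible hirr (T := fun s => ∀ a, f (s, a) = f x)
        (fun s s' hs hss' a' => ?_) (fun a => hedge x.1 x.2 i a hi)
      obtain ⟨a, -, ha⟩ := Finset.exists_lt_of_sum_lt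
        (s := Finset.univ) (f := fun _ => (0 : ℝ)) (by simpa [stateMatrix] using hss')
      rw [hedge s a s' a' (pos_of_mul_pos_right ha (hπpos s a).le), hs]
    have : ∑ z, sampleProb M π θ 1 z * f z.1 = f x := by
      rw [Finset.sum_congr rfl fun z _ => by rw [show f z.1 = f x from hconst _ _],
        ← Finset.sum_mul, sum_sampleProb hγ hirr, one_mul]
    rw [← this, hf1]

end Occupancy

/-! ### The mean dynamics of the algorithm -/

section MeanDynamics

open Matrix

theorem eq_zero_of_forall_dotProduct_eq_zero {S A : Type*} {d : ℕ} {Φ : S × A → Fin d → ℝ}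
    (hΦ : LinearIndependent ℝ (featureMatrix Φ).row)
    {x : Fin d → ℝ} (hx : ∀ y, x ⬝ᵥ Φ y = 0) : x = 0 := by
  funext i
  refine Fintype.linearIndependent_iff.1 hΦ x ?_ i
  ext y
  simpa [featureMatrix, dotProduct, Finset.sum_apply] using hx y

theorem stackTwo_step {S A : Type*} [Fintype A] {n d : ℕ} (π : Policy n S A) (θ : EuclideanSpace ℝ (Fin n)) (Φ : S × A → Fin d → ℝ)
    (γ ε : ℝ) (z : (S × A) × (S × A)) (p : Params d n) :
    (step π θ Φ γ 0 ε z p).stackTwo =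
      p.stackTwo + ε • (sampleGTwo Φ γ z * p.stackTwo + sampleHTwo π θ Φ z) := by
  ext (i | i) k
  · simp [step, Params.stackTwo, sampleGTwo, sampleHTwo, Matrix.mul_apply]
    ring
  · simp [step, Params.stackTwo, sampleGTwo, sampleHTwo, Matrix.mul_apply]
    ring

variable {S A : Type*} [Fintype S] [Fintype A] {n d : ℕ}
  {M : MDP S A} {π : Policy n S A} {θ : EuclideanSpace ℝ (Fin n)} {Φ : S × A → Fin d → ℝ}

theorem sampleMean_apply (γ : ℝ) {I J : Type*} (F : (S × A) × (S × A) → Matrix I J ℝ) (i : I)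
    (j : J) : sampleMean M π θ γ F i j = ∑ z, sampleProb M π θ γ z * F z i j := by
  simp [sampleMean, Matrix.sum_apply]

theorem dotProduct_sampleMean_sampleC (γ : ℝ) (x : Fin d → ℝ) :
    x ⬝ᵥ sampleMean M π θ γ (sampleC Φ) *ᵥ x =
      ∑ y, occupancy M π θ γ y * (x ⬝ᵥ Φ y) ^ 2 := by
  rw [← sum_sampleProb_mul_fst γ fun y => (x ⬝ᵥ Φ y) ^ 2, sampleMean, sum_mulVec, dotProduct_sum]
  refine Finset.sum_congr rfl fun z _ => ?_
  simp only [sampleC, smul_mulVec, dotProduct_smul, vecMulVec_mulVec, smul_eq_mul,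
    op_smul_eq_smul, dotProduct_comm (Φ z.1) x]
  ring

theorem dotProduct_sampleMean_sampleA (γ : ℝ) (x : Fin d → ℝ) :
    x ⬝ᵥ sampleMean M π θ γ (sampleA Φ γ) *ᵥ x =
      ∑ z, sampleProb M π θ γ z * ((x ⬝ᵥ Φ z.1) * (x ⬝ᵥ Φ z.1 - γ * x ⬝ᵥ Φ z.2)) := by
  rw [sampleMean, sum_mulVec, dotProduct_sum]
  refine Finset.sum_congr rfl fun z _ => ?_
  simp only [sampleA, smul_mulVec, sub_mulVec, dotProduct_smul, dotProduct_sub, vecMulVec_mulVec,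
    smul_eq_mul, op_smul_eq_smul, dotProduct_comm (Φ z.1) x, dotProduct_comm (Φ z.2) x]
  ring

theorem dotProduct_sampleMean_sampleC_pos {γ : ℝ} (hγ : γ ∈ Set.Icc (0 : ℝ) 1)
    (hirr : (stateMatrix M π θ).IsIrreducible) (hπpos : ∀ s a, 0 < π.prob θ s a)
    (hinit : γ = 0 → ∀ s, 0 < M.init s) (hΦ : LinearIndependent ℝ (featureMatrix Φ).row)
    {x : Fin d → ℝ} (hx : x ≠ 0) : 0 < x ⬝ᵥ sampleMean M π θ γ (sampleC Φ) *ᵥ x := by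
  have hocc := occupancy_pos hγ hirr hπpos hinit
  obtain ⟨y, hy⟩ : ∃ y, x ⬝ᵥ Φ y ≠ 0 := by
    by_contra! h
    exact hx (eq_zero_of_forall_dotProduct_eq_zero hΦ h)
  rw [dotProduct_sampleMean_sampleC]
  exact Finset.sum_pos' (fun y _ => mul_nonneg (hocc y).le (sq_nonneg _))
    ⟨y, Finset.mem_univ y, mul_pos (hocc y) (by positivity)⟩

theorem hasLyapunov_sampleMean_sampleGTwo {γ : ℝ} (hγ : γ ∈ Set.Icc (0 : ℝ) 1)
    (hirr : (stateMatrix M π θ).IsIrreducible) (hπpos : ∀ s a, 0 < π.prob θ s a)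
    (hinit : γ = 0 → ∀ s, 0 < M.init s) (hΦ : LinearIndependent ℝ (featureMatrix Φ).row)
    (hA : IsUnit (sampleMean M π θ γ (sampleA Φ γ)).det) :
    HasLyapunov (sampleMean M π θ γ (sampleGTwo Φ γ)) := by
  have hG : sampleMean M π θ γ (sampleGTwo Φ γ) =
      fromBlocks 0 (-sampleMean M π θ γ (sampleA Φ γ)) (sampleMean M π θ γ (sampleA Φ γ))ᵀ
        (-sampleMean M π θ γ (sampleC Φ)) := by
    ext (i | i) (j | j) <;> simp [sampleMean_apply, sampleGTwo]
  rw [hG]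
  refine HasLyapunov.saddle (fun x hx => ?_)
    fun y => dotProduct_sampleMean_sampleC_pos hγ hirr hπpos hinit hΦ
  exact eq_zero_of_mulVec_eq_zero (by rw [det_transpose]; exact hA.ne_zero) hx

/-- The regulariser acts as an additional column `l E[Φ]` of the constraint matrix, which detects
the kernel of `E[A_t]ᵀ`: for `γ = 1` the combinations of features in that kernel are constant. -/
theorem hasLyapunov_sampleMean_sampleG {γ : ℝ} (hγ : γ ∈ Set.Icc (0 : ℝ) 1)
    (hirr : (stateMatrix M π θ).IsIrreducible) (hπpos : ∀ s a, 0 < π.prob θ s a)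
    (hinit : γ = 0 → ∀ s, 0 < M.init s) (hΦ : LinearIndependent ℝ (featureMatrix Φ).row)
    {l : ℝ} (hl : 0 < l) : HasLyapunov (sampleMean M π θ γ (sampleG Φ γ l)) := by
  set φ : Fin d → ℝ := ∑ z, sampleProb M π θ γ z • Φ z.1 with hφ
  set N : Matrix (Fin d) (Fin d ⊕ Unit) ℝ :=
    fromCols (sampleMean M π θ γ (sampleA Φ γ)) (replicateCol Unit (l • φ)) with hN
  set D : Matrix (Fin d ⊕ Unit) (Fin d ⊕ Unit) ℝ :=
    fromBlocks (sampleMean M π θ γ (sampleC Φ)) 0 0 (l • 1) with hD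
  have hG : sampleMean M π θ γ (sampleG Φ γ l) =
      (fromBlocks 0 (-N) Nᵀ (-D)).submatrix (Equiv.sumAssoc _ _ _) (Equiv.sumAssoc _ _ _) := by
    have hmul : ∀ i, ∑ z, sampleProb M π θ γ z * (l * Φ z.1 i) =
        l * ∑ z, sampleProb M π θ γ z * Φ z.1 i := fun i => by
      rw [Finset.mul_sum]
      exact Finset.sum_congr rfl fun z _ => by ring
    ext ((i | i) | i) ((j | j) | j) <;>
      simp [sampleMean_apply, sampleG, sampleGTwo, hN, hD, hφ, Finset.sum_apply, hmul,
        ← Finset.sum_mul, sum_sampleProb hγ hirr]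
  rw [hG]
  refine (HasLyapunov.saddle (fun x hx => ?_) fun y hy => ?_).submatrix _
  · rw [hN, transpose_fromCols, fromRows_mulVec] at hx
    have hAx : (sampleMean M π θ γ (sampleA Φ γ))ᵀ *ᵥ x = 0 := by
      simpa using congrArg (· ∘ Sum.inl) hx
    have hφx : φ ⬝ᵥ x = 0 := by
      have : (l • φ) ⬝ᵥ x = 0 := congrFun hx (Sum.inr ())
      simpa [hl.ne'] using this
    refine eq_zero_of_forall_dotProduct_eq_zero hΦ
      (eq_zero_of_sum_sampleProb_mul_eq_zero hγ hirr hπpos hinit (f := fun y => x ⬝ᵥ Φ y) ?_ ?_)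
    · rw [← dotProduct_sampleMean_sampleA, dotProduct_mulVec, ← mulVec_transpose, hAx,
        zero_dotProduct]
    · simpa [hφ, sum_dotProduct, dotProduct_comm x] using hφx
  · obtain ⟨u, τ, rfl⟩ : ∃ u τ, y = Sum.elim u τ := ⟨_, _, (Sum.elim_comp_inl_inr y).symm⟩
    have hquad : Sum.elim u τ ⬝ᵥ D *ᵥ Sum.elim u τ =
        u ⬝ᵥ sampleMean M π θ γ (sampleC Φ) *ᵥ u + l * τ () ^ 2 := by
      simp [hD, fromBlocks_mulVec, smul_mulVec, dotProduct, sq]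
      ring
    rw [hquad]
    rcases eq_or_ne u 0 with rfl | hu
    · have : τ () ≠ 0 := fun h => hy (by ext (i | i) <;> simp [h])
      simp only [zero_dotProduct, zero_add]
      positivity
    · have := dotProduct_sampleMean_sampleC_pos hγ hirr hπpos hinit hΦ hu
      positivity

end MeanDynamics

end LogDensityGradient

theorem mainTheorem2 {S A : Type*} [Fintype S] [Fintype A]
    [MeasurableSpace S] [MeasurableSingletonClass S]
    [MeasurableSpace A] [MeasurableSingletonClass A]
    {n d : ℕ}
    (M : LogDensityGradient.MDP S A) (π : LogDensityGradient.Policy n S A)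
    (θ : EuclideanSpace ℝ (Fin n)) (γ : ℝ) (hγ : γ ∈ Set.Icc (0 : ℝ) 1)
    -- standing assumptions: the induced chain is ergodic and `∇ log π_θ` makes sense
    (hirr : (LogDensityGradient.stateMatrix M π θ).IsIrreducible)
    (hπpos : ∀ s a, 0 < π.prob θ s a)
    (hπdiff : ∀ s a, DifferentiableAt ℝ (fun ϑ => π.prob ϑ s a) θ)
    (hinit : γ = 0 → ∀ s, 0 < M.init s)
    -- linearly independent features
    (Φ : S × A → Fin d → ℝ)
    (hΦ : LinearIndependent ℝ (LogDensityGradient.featureMatrix Φ).row)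
    -- `A` is nonsingular or the regulariser is positive
    (l : ℝ) (hl : 0 ≤ l)
    (hA : IsUnit (LogDensityGradient.sampleMean M π θ γ
      (LogDensityGradient.sampleA Φ γ)).det ∨ 0 < l)
    -- Robbins-Monro step sizes
    (ε : ℕ → ℝ) (hε : ∀ t, 0 ≤ ε t) (hε1 : ¬ Summable ε)
    (hε2 : Summable fun t => ε t ^ 2)
    -- independent samples `((s_t, a_t), (s_t', a_t'))`
    {Ω : Type*} [MeasurableSpace Ω] (μ : Measure Ω) [IsProbabilityMeasure μ]
    (z : ℕ → Ω → (S × A) × (S × A)) (hz : ∀ t, Measurable (z t))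
    (hindep : iIndepFun z μ)
    (hlaw : ∀ t x, μ.real (z t ⁻¹' {x}) = LogDensityGradient.sampleProb M π θ γ x)
    (p₀ : LogDensityGradient.Params d n) :
    (0 < l →
      IsUnit (LogDensityGradient.sampleMean M π θ γ (LogDensityGradient.sampleG Φ γ l)).det ∧
      TendstoInMeasure μ
        (fun t ω =>
          (LogDensityGradient.iterate π θ Φ γ l ε (fun k => z k ω) p₀ t).stack)
        atTop
        (fun _ =>
          -((LogDensityGradient.sampleMean M π θ γ (LogDensityGradient.sampleG Φ γ l))⁻¹ *
            LogDensityGradient.sampleMean M π θ γ (LogDensityGradient.sampleH π θ Φ)))) ∧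
    (l = 0 →
      IsUnit (LogDensityGradient.sampleMean M π θ γ (LogDensityGradient.sampleGTwo Φ γ)).det ∧
      TendstoInMeasure μ
        (fun t ω =>
          (LogDensityGradient.iterate π θ Φ γ l ε (fun k => z k ω) p₀ t).stackTwo)
        atTop
        (fun _ =>
          -((LogDensityGradient.sampleMean M π θ γ (LogDensityGradient.sampleGTwo Φ γ))⁻¹ *
            LogDensityGradient.sampleMean M π θ γ (LogDensityGradient.sampleHTwo π θ Φ))) ∧
      ∀ t ω, (LogDensityGradient.iterate π θ Φ γ l ε (fun k => z k ω) p₀ t).τ = p₀.τ) := by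
  refine ⟨fun hl0 => ?_, ?_⟩
  · have hG := LogDensityGradient.hasLyapunov_sampleMean_sampleG hγ hirr hπpos hinit hΦ hl0
    refine ⟨hG.isUnit_det, ?_⟩
    exact LogDensityGradient.tendstoInMeasure_of_hasLyapunov hG hε hε1 hε2 hz hindep hlaw
      p₀.stack (fun _ => rfl)
      fun t ω => LogDensityGradient.stack_step π θ Φ γ l (ε t) (z t ω) _
  · rintro rfl
    have hG := LogDensityGradient.hasLyapunov_sampleMean_sampleGTwo hγ hirr hπpos hinit hΦ
      (hA.resolve_right (lt_irrefl 0))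
    refine ⟨hG.isUnit_det, ?_, fun t ω => ?_⟩
    · exact LogDensityGradient.tendstoInMeasure_of_hasLyapunov hG hε hε1 hε2 hz hindep hlaw
        p₀.stackTwo (fun _ => rfl)
        fun t ω => LogDensityGradient.stackTwo_step π θ Φ γ (ε t) (z t ω) _
    · induction t with
      | zero => rfl
      | succ t ih => simpa [LogDensityGradient.iterate, LogDensityGradient.step] using ih
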